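/- Let $V$ be a Euclidean Jordan algebra, i.e. a finite-dimensional real inner product space with a commutative bilinear product with unit $e$ such that $(xy)x^2=x(yx^2)$ and $\langle xy,z\rangle=\langle y,xz\rangle$ for all $x,y,z$. Let $Q=\{x^2 : x\in V\}$ be its cone of squares. For a nonempty closed convex set $D\subset V$ let $P_D$ be the nearest-point projection onto $D$, and put $x\sqcap_Q y=P_{x-Q}\,y$ and $x\sqcup_Q y=P_{x+Q}\,y$. A set $M\subset V$ is called lattice-like if $x\sqcap_Q y\in M$ and $x\sqcup_Q y\in M$ for all $x,y\in M$. Let $V=\bigoplus_{i=1}^k V_i$ be the decomposition of $V$ as a (Jordan-algebraic) direct sum of simple Euclidean Jordan algebras: each $V_i$ is a subspace of $V$ which, with the inherited product and inner product and with a unit of its own, is a simple Euclidean Jordan algebra (nonzero and without nontrivial ideals), and $V_iV_j=\{0\}$ for $i\neq j$. The rank of a Euclidean Jordan algebra is the largest degree of the minimal polynomial of an element, i.e. the largest $r$ such that $e,x,\dots,x^{r-1}$ are linearly independent for some element $x$, where $e$ is the unit of that algebra. If $H=\{x\in V : \langle a,x\rangle=0\}$, $a\neq 0$, is a hyperplane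 through the origin which is lattice-like, then $V_i\subset H$ for every $i$ such that $V_i$ has rank at least $3$. -/

import Mathlib

open scoped InnerProductSpace

noncomputable section

/-- A Euclidean Jordan algebra structure on a (finite-dimensional) real inner product space `E`:
a commutative bilinear product with unit that satisfies the Jordan identity
(the identity of Mathlib's `IsCommJordan`), and for which the inner product is associative. -/
structure EuclideanJordanAlgebra (E : Type*) [NormedAddCommGroup E] [InnerProductSpace ℝ E] where
  /-- the Jordan product -/
  mul : E →ₗ[ℝ] E →ₗ[ℝ] E
  /-- the unit -/
  one : E
  mul_comm : ∀ x y, mul x y = mul y x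
  jordan : ∀ x y, mul (mul x y) (mul x x) = mul x (mul y (mul x x))
  one_mul : ∀ x, mul one x = x
  inner_mul : ∀ x y z, ⟪mul x y, z⟫_ℝ = ⟪y, mul x z⟫_ℝ

namespace EuclideanJordanAlgebra

variable {E : Type*} [NormedAddCommGroup E] [InnerProductSpace ℝ E]

/-- The cone of squares `Q = {x² : x ∈ E}`. -/
def coneOfSquares (J : EuclideanJordanAlgebra E) : Set E :=
  Set.range fun x => J.mul x x

/-- The powers `x⁰ = e`, `xⁿ⁺¹ = x xⁿ`. -/
def pow (J : EuclideanJordanAlgebra E) (x : E) : ℕ → E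
  | 0 => J.one
  | n + 1 => J.mul x (J.pow x n)

/-- The rank: the largest degree of the minimal polynomial of an element, i.e. the largest `k`
such that `e, x, …, xᵏ⁻¹` are linearly independent for some `x`. -/
def rank (J : EuclideanJordanAlgebra E) : ℕ :=
  sSup {k : ℕ | ∃ x : E, LinearIndependent ℝ fun j : Fin k => J.pow x j}

/-- In finite dimension the supremum that defines the rank is over a bounded set. -/
theorem bddAbove_rank [FiniteDimensional ℝ E] (J : EuclideanJordanAlgebra E) :
    BddAbove {k : ℕ | ∃ x : E, LinearIndependent ℝ fun j : Fin k => J.pow x j} := by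
  refine ⟨Module.finrank ℝ E, ?_⟩
  rintro k ⟨x, hx⟩
  simpa using hx.fintype_card_le_finrank

/-- An ideal: a subspace `I` with `E I ⊆ I`. -/
def IsIdeal (J : EuclideanJordanAlgebra E) (I : Submodule ℝ E) : Prop :=
  ∀ x : E, ∀ y ∈ I, J.mul x y ∈ I

/-- A Euclidean Jordan algebra is simple if it is nonzero and has no nontrivial ideal. -/
def IsSimple (J : EuclideanJordanAlgebra E) : Prop :=
  Nontrivial E ∧ ∀ I : Submodule ℝ E, J.IsIdeal I → I = ⊥ ∨ I = ⊤

/-- `E = V₁ ⊕ ⋯ ⊕ Vₖ` as a direct sum of simple Euclidean Jordan algebras: each `Vᵢ` is a subspace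
that is, with the inherited inner product and the inherited Jordan product (and a unit of its own),
a simple Euclidean Jordan algebra, `E` is the direct sum of the subspaces `Vᵢ`, and
`Vᵢ Vⱼ = 0` for `i ≠ j`. -/
structure IsSimpleDecomposition (J : EuclideanJordanAlgebra E) {k : ℕ}
    (V : Fin k → Submodule ℝ E) (A : ∀ i, EuclideanJordanAlgebra (V i)) : Prop where
  isInternal : DirectSum.IsInternal V
  coe_mul : ∀ (i : Fin k) (x y : V i), ((A i).mul x y : E) = J.mul x y
  mul_eq_zero : ∀ i j : Fin k, i ≠ j → ∀ x ∈ V i, ∀ y ∈ V j, J.mul x y = 0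
  isSimple : ∀ i, (A i).IsSimple

end EuclideanJordanAlgebra

section LatticeLike

variable {E : Type*} [NormedAddCommGroup E] [InnerProductSpace ℝ E]

/-- The metric projection onto `D`: the point of `D` nearest to `x`
(it exists and is unique when `D` is nonempty, closed and convex and `E` is complete). -/
def metricProj (D : Set E) (x : E) : E :=
  Classical.epsilon fun p => p ∈ D ∧ ∀ y ∈ D, ‖x - p‖ ≤ ‖x - y‖

/-- The lattice-like operation `x ⊓_K y = P_{x - K} y`. -/
def coneInf (K : Set E) (x y : E) : E :=
  metricProj ((fun k => x - k) '' K) y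

/-- The lattice-like operation `x ⊔_K y = P_{x + K} y`. -/
def coneSup (K : Set E) (x y : E) : E :=
  metricProj ((fun k => x + k) '' K) y

/-- A set is lattice-like (with respect to `K`) if it is invariant under `⊓_K` and `⊔_K`. -/
def IsLatticeLike (K : Set E) (M : Set E) : Prop :=
  ∀ x ∈ M, ∀ y ∈ M, coneInf K x y ∈ M ∧ coneSup K x y ∈ M

/-- A hyperplane through the origin: `{x : ⟨a, x⟩ = 0}` for some `a ≠ 0`. -/
def IsHyperplane (H : Submodule ℝ E) : Prop :=
  ∃ a : E, a ≠ 0 ∧ ∀ x : E, x ∈ H ↔ ⟪a, x⟫_ℝ = 0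

end LatticeLike

end

namespace EuclideanJordanAlgebra

section Algebra

variable {W : Type*} [NormedAddCommGroup W] [InnerProductSpace ℝ W]
  (J : EuclideanJordanAlgebra W)

theorem mul_one (x : W) : J.mul x J.one = x := by rw [J.mul_comm, J.one_mul]

/-- The Jordan identity, linearised once. -/
theorem jordan_linearised (x y z : W) :
    J.mul y (J.mul (J.mul x x) z) - J.mul (J.mul x x) (J.mul y z)
      + (2 : ℝ) • (J.mul x (J.mul (J.mul x y) z) - J.mul (J.mul x y) (J.mul x z)) = 0 := by
  have F : ∀ x z : W, J.mul x (J.mul (J.mul x x) z) - J.mul (J.mul x x) (J.mul x z) = 0 := by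
    intro x z
    have h := J.jordan x z
    rw [J.mul_comm (J.mul x z), J.mul_comm z] at h
    rw [h, sub_self]
  have h1 := F (y + x) z
  have h2 := F (y - x) z
  have h3 := F y z
  simp only [map_add, map_sub, LinearMap.add_apply, LinearMap.sub_apply, J.mul_comm y x] at h1 h2
  have key : (2 : ℝ) • (J.mul y (J.mul (J.mul x x) z) - J.mul (J.mul x x) (J.mul y z)
      + (2 : ℝ) • (J.mul x (J.mul (J.mul x y) z) - J.mul (J.mul x y) (J.mul x z))) = 0 := by
    linear_combination (norm := module) h1 + h2 - (2 : ℝ) • h3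
  exact (smul_eq_zero.mp key).resolve_left two_ne_zero

/-- The fully linearised Jordan identity. -/
theorem jordan_polarised (x y w z : W) :
    J.mul x (J.mul (J.mul y w) z) - J.mul (J.mul y w) (J.mul x z)
      + (J.mul y (J.mul (J.mul w x) z) - J.mul (J.mul w x) (J.mul y z))
      + (J.mul w (J.mul (J.mul x y) z) - J.mul (J.mul x y) (J.mul w z)) = 0 := by
  have h1 := J.jordan_linearised (y + w) x z
  have h2 := J.jordan_linearised y x z
  have h3 := J.jordan_linearised w x z
  simp only [map_add, LinearMap.add_apply, J.mul_comm w y, J.mul_comm y x] at h1 h2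
  have key : (2 : ℝ) • (J.mul x (J.mul (J.mul y w) z) - J.mul (J.mul y w) (J.mul x z)
      + (J.mul y (J.mul (J.mul w x) z) - J.mul (J.mul w x) (J.mul y z))
      + (J.mul w (J.mul (J.mul x y) z) - J.mul (J.mul x y) (J.mul w z))) = 0 := by
    linear_combination (norm := module) h1 - h2 - h3
  exact (smul_eq_zero.mp key).resolve_left two_ne_zero

/-- Multiplication by a triple product, in terms of multiplications by products of pairs. -/
theorem mul_triple (x y w z : W) :
    J.mul (J.mul (J.mul x y) w) z = J.mul (J.mul x w) (J.mul y z)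
      + J.mul (J.mul y w) (J.mul x z) + J.mul (J.mul x y) (J.mul w z)
      - J.mul x (J.mul w (J.mul y z)) - J.mul y (J.mul w (J.mul x z)) := by
  have h := J.jordan_polarised x y z w
  rw [J.mul_comm (J.mul y z) w, J.mul_comm (J.mul z x) w, J.mul_comm (J.mul x y) w,
    J.mul_comm (J.mul y z) (J.mul x w), J.mul_comm (J.mul z x) (J.mul y w), J.mul_comm z x,
    J.mul_comm z (J.mul w (J.mul x y)), J.mul_comm w (J.mul x y), J.mul_comm z w] at h
  linear_combination (norm := module) h

theorem commute_pow (x : W) (n : ℕ) : ∀ z,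
    J.mul x (J.mul (J.pow x n) z) = J.mul (J.pow x n) (J.mul x z) := by
  induction n using Nat.strong_induction_on with
  | _ n ih =>
    match n with
    | 0 => intro z; simp [pow, J.one_mul]
    | 1 => intro z; simp [pow, J.mul_one]
    | n + 2 =>
      intro z
      have h0 := ih n (by omega)
      have h1 := ih (n + 1) (by omega)
      have h2 : ∀ z, J.mul x (J.mul (J.mul x x) z) = J.mul (J.mul x x) (J.mul x z) := by
        intro z
        rw [J.mul_comm (J.mul x x) z, ← J.jordan, J.mul_comm]
      have e : ∀ z, J.mul (J.pow x (n + 2)) z = J.mul (J.mul x x) (J.mul (J.pow x n) z)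
          + (2 : ℝ) • J.mul (J.pow x (n + 1)) (J.mul x z)
          - J.mul x (J.mul x (J.mul (J.pow x n) z))
          - J.mul (J.pow x n) (J.mul x (J.mul x z)) := by
        intro z
        have := J.mul_triple x (J.pow x n) x z
        have e1 : J.mul x (J.pow x n) = J.pow x (n + 1) := rfl
        have e2 : J.mul (J.pow x n) x = J.pow x (n + 1) := J.mul_comm _ _
        have e3 : J.mul (J.pow x (n + 1)) x = J.pow x (n + 2) := J.mul_comm _ _
        rw [e2, e1, e3] at this
        rw [this, two_smul]
        abel
      rw [e, e]
      simp only [map_add, map_sub, map_smul, h0, h1, h2]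

theorem inner_mul_left (x y z : W) : ⟪J.mul x y, z⟫_ℝ = ⟪x, J.mul y z⟫_ℝ := by
  rw [J.mul_comm, J.inner_mul]

/-- The Peirce polynomial of an idempotent. -/
theorem peirce {c : W} (hc : J.mul c c = c) (z : W) :
    (2 : ℝ) • J.mul c (J.mul c (J.mul c z)) - (3 : ℝ) • J.mul c (J.mul c z) + J.mul c z = 0 := by
  have h := J.mul_triple c c c z
  simp only [hc] at h
  linear_combination (norm := module) h

theorem inner_idempotent_sq {c : W} (hc : J.mul c c = c) (z : W) :
    ‖J.mul c z‖ ^ 2 ≤ ⟪c, J.mul z z⟫_ℝ := by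
  have hs : ∀ u v : W, ⟪u, J.mul c v⟫_ℝ = ⟪J.mul c u, v⟫_ℝ := fun u v => (J.inner_mul c u v).symm
  have h1 := J.peirce hc z
  have h0 := J.peirce hc (J.mul c z)
  set u := J.mul c z - J.mul c (J.mul c z) with hu
  have key : ⟪c, J.mul z z⟫_ℝ = ‖J.mul c z‖ ^ 2 + 4 * ‖u‖ ^ 2 := by
    have e : J.mul c z = J.mul c (J.mul c z) + (4 : ℝ) • (J.mul c (J.mul c z)
        - (2 : ℝ) • J.mul c (J.mul c (J.mul c z)) + J.mul c (J.mul c (J.mul c (J.mul c z)))) := by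
      linear_combination (norm := module) h1 - (2 : ℝ) • h0
    have e' := congrArg (fun v => ⟪v, z⟫_ℝ) e
    rw [← J.inner_mul_left, ← real_inner_self_eq_norm_sq, ← real_inner_self_eq_norm_sq, hu]
    simp only [map_sub, inner_add_left, inner_sub_left, inner_sub_right, real_inner_smul_left,
      hs] at e' ⊢
    linarith
  rw [key]
  nlinarith [sq_nonneg ‖u‖]

theorem mul_eq_zero_of_inner_eq_zero {c : W} (hc : J.mul c c = c) {z : W}
    (h : ⟪c, J.mul z z⟫_ℝ = 0) : J.mul c z = 0 := by
  have := J.inner_idempotent_sq hc z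
  rw [h] at this
  have h2 : ‖J.mul c z‖ = 0 := by nlinarith [norm_nonneg (J.mul c z)]
  simpa using h2

/-- A resolution of the unit into orthogonal idempotents that diagonalises `x`. -/
structure IsSpectral (x : W) (S : Finset ℝ) (p : ℝ → W) : Prop where
  sum_eq_one : ∑ t ∈ S, p t = J.one
  sum_smul : ∑ t ∈ S, t • p t = x
  idem : ∀ t ∈ S, J.mul (p t) (p t) = p t
  orth : ∀ s ∈ S, ∀ t ∈ S, s ≠ t → J.mul (p s) (p t) = 0

theorem exists_isSpectral [FiniteDimensional ℝ W] (x : W) : ∃ S p, J.IsSpectral x S p := by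
  classical
  set T : Module.End ℝ W := J.mul x with hT
  have hsym : T.IsSymmetric := fun u v => J.inner_mul x u v
  have hfin : Set.Finite {t : ℝ | T.HasEigenvalue t} := Module.End.finite_hasEigenvalue T
  set S : Finset ℝ := hfin.toFinset with hS
  have hker : Polynomial.aeval T (∏ t ∈ S, (Polynomial.X - Polynomial.C t)) = 0 := by
    have hle : (⨆ t, T.eigenspace t) ≤
        LinearMap.ker (Polynomial.aeval T (∏ t ∈ S, (Polynomial.X - Polynomial.C t))) := by
      refine iSup_le fun t v hv => ?_
      rcases eq_or_ne v 0 with rfl | hv0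
      · simp
      have he : T.HasEigenvector t v := ⟨hv, hv0⟩
      have ht : t ∈ S := by
        simpa [hS] using Module.End.hasEigenvalue_of_hasEigenvector he
      rw [LinearMap.mem_ker, Module.End.aeval_apply_of_hasEigenvector he,
        Polynomial.eval_prod, Finset.prod_eq_zero ht (by simp), zero_smul]
    have htop : (⨆ t, T.eigenspace t) = ⊤ := by
      have := hsym.orthogonalComplement_iSup_eigenspaces_eq_bot
      rwa [Submodule.orthogonal_eq_bot_iff] at this
    rw [htop, top_le_iff] at hle
    exact LinearMap.ker_eq_top.mp hle
  have hne : S.Nonempty ∨ Subsingleton W := by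
    rcases S.eq_empty_or_nonempty with h | h
    · right
      rw [h] at hker
      simp only [Finset.prod_empty, map_one] at hker
      exact ⟨fun u v => by
        rw [← Module.End.one_apply (R := ℝ) u, ← Module.End.one_apply (R := ℝ) v, hker]; rfl⟩
    · exact Or.inl h
  rcases hne with hne | hsub
  swap
  · exact ⟨∅, 0, Subsingleton.elim _ _, Subsingleton.elim _ _, by simp, by simp⟩
  set q : ℝ → Polynomial ℝ := fun t => Lagrange.basis S id t with hq
  have hinj : Set.InjOn (id : ℝ → ℝ) S := Function.injective_id.injOn
  set p : ℝ → W := fun t => Polynomial.aeval T (q t) J.one with hp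
  have hsum : ∑ t ∈ S, p t = J.one := by
    simp only [hp]
    rw [← LinearMap.sum_apply, ← map_sum, Lagrange.sum_basis hinj hne, map_one]
    rfl
  have heig : ∀ t ∈ S, J.mul x (p t) = t • p t := by
    intro t ht
    have h1 : (Polynomial.X - Polynomial.C t) * q t =
        Polynomial.C (Lagrange.nodalWeight S id t) * ∏ t ∈ S, (Polynomial.X - Polynomial.C t) := by
      have h := Lagrange.nodal_eq_mul_nodal_erase (v := (id : ℝ → ℝ)) ht
      have h' := Lagrange.nodal_eq S (id : ℝ → ℝ)
      simp only [id] at h h'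
      rw [hq, ← h', h]
      simp only [Lagrange.basis_eq_prod_sub_inv_mul_nodal_div ht,
        ← Lagrange.nodal_erase_eq_nodal_div ht]
      ring
    have h2 := congrArg (fun r => Polynomial.aeval T r J.one) h1
    simp only [map_mul, hker, mul_zero] at h2
    simp only [map_sub, Polynomial.aeval_X, Polynomial.aeval_C, Module.End.mul_apply,
      LinearMap.sub_apply, Module.algebraMap_end_apply, LinearMap.zero_apply] at h2
    exact sub_eq_zero.mp h2
  have hpow : ∀ n : ℕ, (T ^ n) J.one = J.pow x n := by
    intro n
    induction n with
    | zero => rfl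
    | succ n ih => rw [pow_succ', Module.End.mul_apply, ih]; rfl
  have hcomm : ∀ (r : Polynomial ℝ) (z : W), J.mul x (J.mul (Polynomial.aeval T r J.one) z)
      = J.mul (Polynomial.aeval T r J.one) (J.mul x z) := by
    intro r z
    induction r using Polynomial.induction_on' with
    | add r s hr hs => simp only [map_add, LinearMap.add_apply, hr, hs]
    | monomial n b =>
      rw [Polynomial.aeval_monomial, Module.End.mul_apply, hpow, Module.algebraMap_end_apply]
      simp only [map_smul, LinearMap.smul_apply, J.commute_pow]
  have horth : ∀ s ∈ S, ∀ t ∈ S, s ≠ t → J.mul (p s) (p t) = 0 := by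
    intro s hs t ht hst
    have h1 : J.mul x (J.mul (p s) (p t)) = t • J.mul (p s) (p t) := by
      rw [hcomm, heig t ht, map_smul]
    have h2 : J.mul x (J.mul (p s) (p t)) = s • J.mul (p s) (p t) := by
      rw [J.mul_comm (p s), hcomm, heig s hs, map_smul]
    rw [h1, ← sub_eq_zero, ← sub_smul] at h2
    exact (smul_eq_zero.mp h2).resolve_left (sub_ne_zero.mpr hst.symm)
  refine ⟨S, p, hsum, ?_, ?_, horth⟩
  · rw [← Finset.sum_congr rfl heig, ← map_sum, hsum, J.mul_one]
  · intro t ht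
    have h : J.mul (p t) (∑ s ∈ S, p s) = J.mul (p t) (p t) := by
      rw [map_sum]
      exact Finset.sum_eq_single t (fun s hs hst => horth t ht s hs hst.symm) (fun h => (h ht).elim)
    rw [← h, hsum, J.mul_one]

namespace IsSpectral

variable {J} {x : W} {S : Finset ℝ} {p : ℝ → W}

theorem sum_mul_sum (h : J.IsSpectral x S p) (f g : ℝ → ℝ) :
    J.mul (∑ t ∈ S, f t • p t) (∑ t ∈ S, g t • p t) = ∑ t ∈ S, (f t * g t) • p t := by
  rw [map_sum J.mul, LinearMap.sum_apply]
  refine Finset.sum_congr rfl fun s hs => ?_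
  rw [map_sum, Finset.sum_eq_single s]
  · rw [map_smul, map_smul, LinearMap.smul_apply, h.idem s hs, smul_smul, _root_.mul_comm]
  · intro t ht hts
    rw [map_smul, map_smul, LinearMap.smul_apply, h.orth s hs t ht hts.symm, smul_zero, smul_zero]
  · exact fun h => (h hs).elim

theorem inner_nonneg (h : J.IsSpectral x S p) {t : ℝ} (ht : t ∈ S) (z : W) :
    0 ≤ ⟪p t, J.mul z z⟫_ℝ :=
  (sq_nonneg _).trans (J.inner_idempotent_sq (h.idem t ht) z)

end IsSpectral

theorem inner_sq_sq_nonneg [FiniteDimensional ℝ W] (x y : W) :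
    0 ≤ ⟪J.mul x x, J.mul y y⟫_ℝ := by
  obtain ⟨S, p, h⟩ := J.exists_isSpectral x
  have e := h.sum_mul_sum id id
  simp only [id, h.sum_smul] at e
  rw [e, sum_inner]
  refine Finset.sum_nonneg fun t ht => ?_
  rw [real_inner_smul_left]
  exact mul_nonneg (mul_self_nonneg t) (h.inner_nonneg ht y)

end Algebra

section HalfSpace

variable {W : Type*} [NormedAddCommGroup W] [InnerProductSpace ℝ W]
  {J : EuclideanJordanAlgebra W}

theorem inner_sum_smul (p : W) (R : Finset ℝ) (f : ℝ → ℝ) (q : ℝ → W) :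
    ⟪p, ∑ r ∈ R, f r • q r⟫_ℝ = ∑ r ∈ R, f r * ⟪p, q r⟫_ℝ := by
  simp only [inner_sum, real_inner_smul_right]

theorem inner_idempotent_nonneg {c d : W} (hc : J.mul c c = c) (hd : J.mul d d = d) :
    0 ≤ ⟪c, d⟫_ℝ := by
  have := (sq_nonneg _).trans (J.inner_idempotent_sq hc d)
  rwa [hd] at this

/-- If `⟨a, u²⟩ = ⟨a, v²⟩` forces `⟨a, u²⟩ = 0` for orthogonal squares, then an element of `aᗮ` that
is annihilated by the negative part of `a` is annihilated by the positive part of `a`. -/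
theorem sum_mul_eq_zero [FiniteDimensional ℝ W] {a : W}
    (hC : ∀ u v : W, ⟪J.mul u u, J.mul v v⟫_ℝ = 0 → ⟪a, J.mul u u⟫_ℝ = ⟪a, J.mul v v⟫_ℝ →
      ⟪a, J.mul u u⟫_ℝ = 0)
    {s t : Finset ℝ} {α β : ℝ → ℝ} {p : ℝ → W}
    (hs : ∀ i ∈ s, J.mul (p i) (p i) = p i) (ht : ∀ i ∈ t, J.mul (p i) (p i) = p i)
    (hα : ∀ i ∈ s, 0 < α i) (ha : a = ∑ i ∈ s, α i • p i - ∑ i ∈ t, β i • p i)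
    {x : W} (hx : J.mul (∑ i ∈ t, p i) x = 0) (hax : ⟪a, x⟫_ℝ = 0) :
    J.mul (∑ i ∈ s, p i) x = 0 := by
  obtain ⟨R, q, h⟩ := J.exists_isSpectral x
  have hsq : J.mul x x = ∑ r ∈ R, (r * r) • q r := by
    have := h.sum_mul_sum id id
    simpa only [id, h.sum_smul] using this
  have hR : ∀ i ∈ t, ∀ r ∈ R, r ≠ 0 → ⟪p i, q r⟫_ℝ = 0 := by
    have h0 : ∑ i ∈ t, ∑ r ∈ R, (r * r) * ⟪p i, q r⟫_ℝ = 0 := by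
      simp only [← inner_sum_smul]
      rw [← hsq, ← sum_inner, ← J.inner_mul_left, hx, inner_zero_left]
    have hnn : ∀ i ∈ t, ∀ r ∈ R, 0 ≤ (r * r) * ⟪p i, q r⟫_ℝ := fun i hi r hr =>
      mul_nonneg (mul_self_nonneg r) (inner_idempotent_nonneg (ht i hi) (h.idem r hr))
    intro i hi r hr hr0
    have h1 := (Finset.sum_eq_zero_iff_of_nonneg fun i hi => Finset.sum_nonneg (hnn i hi)).mp h0 i hi
    have h2 := (Finset.sum_eq_zero_iff_of_nonneg (hnn i hi)).mp h1 r hr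
    exact (mul_eq_zero.mp h2).resolve_left (mul_ne_zero hr0 hr0)
  set u : W := ∑ r ∈ R, √(max r 0) • q r with hu
  set v : W := ∑ r ∈ R, √(max (-r) 0) • q r with hv
  have huu : J.mul u u = ∑ r ∈ R, max r 0 • q r := by
    rw [hu, h.sum_mul_sum]
    simp only [Real.mul_self_sqrt (le_max_right _ _)]
  have hvv : J.mul v v = ∑ r ∈ R, max (-r) 0 • q r := by
    rw [hv, h.sum_mul_sum]
    simp only [Real.mul_self_sqrt (le_max_right _ _)]
  have hmm : ∀ r : ℝ, max r 0 * max (-r) 0 = 0 := by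
    intro r
    rcases le_total r 0 with hr | hr
    · rw [max_eq_right hr, zero_mul]
    · rw [max_eq_right (neg_nonpos.mpr hr), mul_zero]
  have huv : ⟪J.mul u u, J.mul v v⟫_ℝ = 0 := by
    rw [← J.one_mul (J.mul u u), J.inner_mul_left, huu, hvv, h.sum_mul_sum]
    simp [hmm]
  have hx' : x = J.mul u u - J.mul v v := by
    rw [huu, hvv, ← Finset.sum_sub_distrib, ← h.sum_smul]
    refine Finset.sum_congr rfl fun r _ => ?_
    rw [← sub_smul]
    congr 1
    rcases le_total r 0 with hr | hr
    · rw [max_eq_right hr, max_eq_left (neg_nonneg.mpr hr)]; ring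
    · rw [max_eq_left hr, max_eq_right (neg_nonpos.mpr hr)]; ring
  have heq : ⟪a, J.mul u u⟫_ℝ = ⟪a, J.mul v v⟫_ℝ := by
    rw [hx', inner_sub_right] at hax
    exact sub_eq_zero.mp hax
  have hau := hC u v huv heq
  have hav : ⟪a, J.mul v v⟫_ℝ = 0 := heq ▸ hau
  have key : ∀ f : ℝ → ℝ, f 0 = 0 → (∀ r, 0 ≤ f r) → ⟪a, ∑ r ∈ R, f r • q r⟫_ℝ = 0 →
      ∀ i ∈ s, ∀ r ∈ R, f r * ⟪p i, q r⟫_ℝ = 0 := by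
    intro f hf0 hf h0
    have hnn : ∀ i ∈ s, ∀ r ∈ R, 0 ≤ f r * ⟪p i, q r⟫_ℝ := fun i hi r hr =>
      mul_nonneg (hf r) (inner_idempotent_nonneg (hs i hi) (h.idem r hr))
    have h1 : ∑ i ∈ s, α i * ∑ r ∈ R, f r * ⟪p i, q r⟫_ℝ = 0 := by
      have h2 : ∑ i ∈ t, β i * ∑ r ∈ R, f r * ⟪p i, q r⟫_ℝ = 0 := by
        refine Finset.sum_eq_zero fun i hi => ?_
        rw [Finset.sum_eq_zero, mul_zero]
        intro r hr
        rcases eq_or_ne r 0 with rfl | hr0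
        · rw [hf0, zero_mul]
        · rw [hR i hi r hr hr0, mul_zero]
      rw [ha, inner_sub_left, sum_inner, sum_inner] at h0
      simp only [real_inner_smul_left] at h0
      simp only [inner_sum_smul] at h0
      rwa [h2, sub_zero] at h0
    intro i hi r hr
    have h3 := (Finset.sum_eq_zero_iff_of_nonneg fun i hi =>
      mul_nonneg (hα i hi).le (Finset.sum_nonneg (hnn i hi))).mp h1 i hi
    exact (Finset.sum_eq_zero_iff_of_nonneg (hnn i hi)).mp
      ((mul_eq_zero.mp h3).resolve_left (hα i hi).ne') r hr
  rw [huu] at hau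
  rw [hvv] at hav
  have k1 := key (fun r => max r 0) (by simp) (fun r => le_max_right _ _) hau
  have k2 := key (fun r => max (-r) 0) (by simp) (fun r => le_max_right _ _) hav
  rw [map_sum, LinearMap.sum_apply]
  refine Finset.sum_eq_zero fun i hi => ?_
  rw [← h.sum_smul, map_sum]
  refine Finset.sum_eq_zero fun r hr => ?_
  rw [map_smul]
  rcases eq_or_ne r 0 with rfl | hr0
  · rw [zero_smul]
  · have h0 : ⟪p i, q r⟫_ℝ = 0 := by
      rcases lt_or_gt_of_ne hr0 with hr' | hr'
      · exact (mul_eq_zero.mp (k2 i hi r hr)).resolve_left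
          (lt_max_of_lt_left (neg_pos.mpr hr')).ne'
      · exact (mul_eq_zero.mp (k1 i hi r hr)).resolve_left (lt_max_of_lt_left hr').ne'
    rw [J.mul_eq_zero_of_inner_eq_zero (hs i hi) (by rwa [h.idem r hr]), smul_zero]

theorem exists_mul_eq_smul {a c d : W} (hcc : J.mul c c = c) (hdc : J.mul d c = 0)
    (h : ∀ x, J.mul d x = 0 → ⟪a, x⟫_ℝ = 0 → J.mul c x = 0) {x : W} (hx : J.mul d x = 0) :
    ∃ τ : ℝ, J.mul c x = τ • c := by
  by_cases hac : ⟪a, c⟫_ℝ = 0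
  · have hc : c = 0 := by rw [← hcc, h c hdc hac]
    exact ⟨0, by simp [hc]⟩
  · refine ⟨⟪a, x⟫_ℝ / ⟪a, c⟫_ℝ, ?_⟩
    have := h (x - (⟪a, x⟫_ℝ / ⟪a, c⟫_ℝ) • c) (by rw [map_sub, map_smul, hx, hdc]; simp)
      (by rw [inner_sub_right, real_inner_smul_right, div_mul_cancel₀ _ hac, sub_self])
    rwa [map_sub, map_smul, hcc, sub_eq_zero] at this

end HalfSpace

section Peirce

variable {W : Type*} [NormedAddCommGroup W] [InnerProductSpace ℝ W]
  {J : EuclideanJordanAlgebra W} {c d g : W}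

theorem commute_of_mul_eq_zero (hg : J.mul g g = g) {x : W} (h : J.mul g x = 0) (z : W) :
    J.mul x (J.mul g z) = J.mul g (J.mul x z) := by
  have := J.jordan_linearised g x z
  simpa [hg, h, sub_eq_zero] using this

theorem commute_of_mul_eq_self (hg : J.mul g g = g) {x : W} (h : J.mul g x = x) (z : W) :
    J.mul x (J.mul g z) = J.mul g (J.mul x z) := by
  have := J.jordan_linearised g x z
  rw [hg, h] at this
  linear_combination (norm := module) -this

/-- The Peirce half-space of `g = e - c - d` vanishes if `c` and `d` act on each other's
annihilators with rank one. -/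
theorem eq_zero_of_mul_eq_half (hc : J.mul c c = c) (hd : J.mul d d = d) (hg : J.mul g g = g)
    (hgc : J.mul g c = 0) (hsum : c + d + g = J.one)
    (hcs : ∀ x, J.mul d x = 0 → ∃ τ : ℝ, J.mul c x = τ • c)
    (hds : ∀ x, J.mul c x = 0 → ∃ τ : ℝ, J.mul d x = τ • d)
    {y : W} (hy : J.mul g y = (1 / 2 : ℝ) • y) : y = 0 := by
  have hhalf : ∀ {e : W}, J.mul e e = e → ∀ {v : W}, J.mul e v = (1 / 2 : ℝ) • v →
      (∃ τ : ℝ, J.mul e v = τ • e) → v = 0 := by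
    rintro e he v hv ⟨τ, h⟩
    have h1 : v = (2 * τ) • e := by
      rw [hv] at h
      linear_combination (norm := module) (2 : ℝ) • h
    have h2 : J.mul e v = (2 * τ) • e := by rw [h1, map_smul, he]
    have h3 : τ • e = 0 := by
      rw [h] at h2
      linear_combination (norm := module) -h2
    rw [h1, mul_smul, h3, smul_zero]
  have hgC : ∀ v, J.mul g v = (1 / 2 : ℝ) • v → J.mul g (J.mul c v) = (1 / 2 : ℝ) • J.mul c v := by
    intro v hv
    rw [← commute_of_mul_eq_zero hg hgc, hv, map_smul]
  have hdv : ∀ v, J.mul g v = (1 / 2 : ℝ) • v → J.mul d v = (1 / 2 : ℝ) • v - J.mul c v := by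
    intro v hv
    have h := J.one_mul v
    rw [← hsum, map_add, map_add, LinearMap.add_apply, LinearMap.add_apply, hv] at h
    linear_combination (norm := module) h
  have g1 := hgC y hy
  have g2 := hgC _ g1
  have pc := J.peirce hc y
  have pd := J.peirce hd y
  rw [hdv y hy] at pd
  simp only [map_sub, map_smul, hdv y hy, hdv _ g1, hdv _ g2] at pd
  have h2 : J.mul c (J.mul c y) = (1 / 2 : ℝ) • J.mul c y := by
    linear_combination (norm := module) (-(1 / 3) : ℝ) • pc - (1 / 3 : ℝ) • pd
  have hcy : J.mul c y = 0 :=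
    hhalf hc h2 (hcs _ (by rw [hdv _ g1, h2, sub_self]))
  refine hhalf hd ?_ (hds y hcy)
  rw [hdv y hy, hcy, sub_zero]

theorem commute_of_half_eq_zero (hg : J.mul g g = g)
    (h : ∀ y, J.mul g y = (1 / 2 : ℝ) • y → y = 0) (x z : W) :
    J.mul x (J.mul g z) = J.mul g (J.mul x z) := by
  have hidem : J.mul g (J.mul g x) = J.mul g x := by
    have := J.peirce hg x
    refine (sub_eq_zero.mp (h (J.mul g x - J.mul g (J.mul g x)) ?_)).symm
    rw [map_sub]
    linear_combination (norm := module) (-(1 / 2) : ℝ) • this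
  have h1 := commute_of_mul_eq_self hg hidem z
  have h0 := commute_of_mul_eq_zero hg (x := x - J.mul g x) (by rw [map_sub, hidem, sub_self]) z
  simp only [map_sub, LinearMap.sub_apply] at h0
  linear_combination (norm := module) h0 + h1

theorem IsSimple.eq_zero_or_one (hJ : J.IsSimple) (hg : J.mul g g = g)
    (h : ∀ x z, J.mul x (J.mul g z) = J.mul g (J.mul x z)) : g = 0 ∨ g = J.one := by
  rcases hJ.2 (LinearMap.ker (J.mul g - LinearMap.id)) (fun x y hy => by
    rw [LinearMap.mem_ker, LinearMap.sub_apply, LinearMap.id_apply, sub_eq_zero] at *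
    rw [← h, hy]) with hI | hI
  · left
    have : g ∈ LinearMap.ker (J.mul g - LinearMap.id) := by simp [hg]
    rwa [hI, Submodule.mem_bot] at this
  · right
    have : J.one ∈ LinearMap.ker (J.mul g - LinearMap.id) := by rw [hI]; trivial
    simpa [sub_eq_zero, J.mul_one] using this

/-- If `e = c + d` with complementary idempotents whose Peirce-one spaces are lines, then
every element is quadratic. -/
theorem exists_sq_eq (hc : J.mul c c = c) (hd : J.mul d d = d) (hcd : J.mul c d = 0)
    (hsum : c + d = J.one)
    (hcs : ∀ x, J.mul c x = x → ∃ τ : ℝ, x = τ • c)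
    (hds : ∀ x, J.mul d x = x → ∃ τ : ℝ, x = τ • d) (x : W) :
    ∃ s t : ℝ, J.mul x x = s • x + t • J.one := by
  have hdv : ∀ v, J.mul d v = v - J.mul c v := by
    intro v
    have h := J.one_mul v
    rw [← hsum, map_add, LinearMap.add_apply] at h
    linear_combination (norm := module) h
  have pc := J.peirce hc x
  obtain ⟨α, hα⟩ := hcs ((2 : ℝ) • J.mul c (J.mul c x) - J.mul c x) (by
    simp only [map_sub, map_smul]
    linear_combination (norm := module) pc)
  obtain ⟨β, hβ⟩ := hds (x - (3 : ℝ) • J.mul c x + (2 : ℝ) • J.mul c (J.mul c x)) (by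
    rw [hdv]
    simp only [map_sub, map_add, map_smul]
    linear_combination (norm := module) -pc)
  set y := (4 : ℝ) • (J.mul c x - J.mul c (J.mul c x)) with hy
  have hx : x = α • c + β • d + y := by
    rw [← hα, ← hβ, hy]
    module
  have hcy : J.mul c y = (1 / 2 : ℝ) • y := by
    rw [hy]
    simp only [map_sub, map_smul]
    linear_combination (norm := module) (-2 : ℝ) • pc
  have hdy : J.mul d y = (1 / 2 : ℝ) • y := by
    rw [hdv, hcy]
    module
  clear_value y
  have hcomm : ∀ z, J.mul c (J.mul (J.mul y y) z) = J.mul (J.mul y y) (J.mul c z) := by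
    intro z
    have := J.jordan_linearised y c z
    rw [J.mul_comm y c, hcy] at this
    simp only [map_smul, LinearMap.smul_apply] at this
    linear_combination (norm := module) this
  have hcomm' : ∀ z, J.mul d (J.mul (J.mul y y) z) = J.mul (J.mul y y) (J.mul d z) := by
    intro z
    rw [hdv, hdv, hcomm, map_sub]
  obtain ⟨γ, hγ⟩ := hcs (J.mul (J.mul y y) c) (by rw [hcomm, hc])
  obtain ⟨δ, hδ⟩ := hds (J.mul (J.mul y y) d) (by rw [hcomm', hd])
  have hyy : J.mul y y = γ • c + δ • d := by
    rw [← hγ, ← hδ, ← map_add, hsum, J.mul_one]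
  have hγδ : y = 0 ∨ γ = δ := by
    have h1 := J.commute_pow y 2 c
    simp only [pow, J.mul_one] at h1
    rw [hγ, J.mul_comm y c, hcy, map_smul, map_smul, J.mul_comm y c, hcy, hyy, map_add, map_smul,
      map_smul, LinearMap.add_apply, LinearMap.smul_apply, LinearMap.smul_apply, hcy, hdy] at h1
    have h2 : (γ - δ) • y = 0 := by
      linear_combination (norm := module) (4 : ℝ) • h1
    rcases smul_eq_zero.mp h2 with h | h
    · exact Or.inr (sub_eq_zero.mp h)
    · exact Or.inl h
  have hxx : J.mul x x = (α + β) • x + (-(α * β)) • J.one + J.mul y y := by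
    rw [← hsum, hx]
    simp only [map_add, map_smul, LinearMap.add_apply, LinearMap.smul_apply, J.mul_comm y c,
      J.mul_comm y d, J.mul_comm d c, hcy, hdy, hc, hd, hcd]
    module
  rcases hγδ with h | h
  · refine ⟨α + β, -(α * β), ?_⟩
    rw [hxx, h]
    simp
  · refine ⟨α + β, γ - α * β, ?_⟩
    rw [hxx, hyy, ← h, ← smul_add, hsum]
    module

theorem rank_lt_three [FiniteDimensional ℝ W]
    (h : ∀ x, ∃ s t : ℝ, J.mul x x = s • x + t • J.one) : J.rank < 3 := by
  by_contra! h3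
  obtain ⟨x, hx⟩ : J.rank ∈ {k : ℕ | ∃ x : W, LinearIndependent ℝ fun j : Fin k => J.pow x j} :=
    Nat.sSup_mem ⟨0, 0, linearIndependent_empty_type⟩ J.bddAbove_rank
  have hx3 : LinearIndependent ℝ fun j : Fin 3 => J.pow x j :=
    hx.comp (Fin.castLE h3) (Fin.castLE_injective h3)
  obtain ⟨s, t, hst⟩ := h x
  have := Fintype.linearIndependent_iff.mp hx3 ![-t, -s, 1] (by
    simp [Fin.sum_univ_three, pow, J.mul_one, hst]) 2
  simp at this

/-- A functional on a simple algebra of rank at least three whose kernel is invariant under the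
positive part is zero. -/
theorem IsSimple.eq_zero_of_rank [FiniteDimensional ℝ W] (hJ : J.IsSimple) (hr : 3 ≤ J.rank) {a : W}
    (hC : ∀ u v : W, ⟪J.mul u u, J.mul v v⟫_ℝ = 0 → ⟪a, J.mul u u⟫_ℝ = ⟪a, J.mul v v⟫_ℝ →
      ⟪a, J.mul u u⟫_ℝ = 0) : a = 0 := by
  obtain ⟨S, p, h⟩ := J.exists_isSpectral a
  set f : ℝ → ℝ := fun t => if 0 < t then 1 else 0 with hf
  set f' : ℝ → ℝ := fun t => if t < 0 then 1 else 0 with hf'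
  set f₀ : ℝ → ℝ := fun t => if t = 0 then 1 else 0 with hf₀
  set c : W := ∑ t ∈ S, f t • p t with hcdef
  set d : W := ∑ t ∈ S, f' t • p t with hddef
  set g : W := ∑ t ∈ S, f₀ t • p t with hgdef
  have hsum : c + d + g = J.one := by
    rw [← h.sum_eq_one, hcdef, hddef, hgdef, ← Finset.sum_add_distrib, ← Finset.sum_add_distrib]
    refine Finset.sum_congr rfl fun t _ => ?_
    rw [← add_smul, ← add_smul]
    rcases lt_trichotomy t 0 with ht | ht | ht
    · simp [hf, hf', hf₀, ht, ht.ne, not_lt_of_gt ht]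
    · simp [hf, hf', hf₀, ht]
    · simp [hf, hf', hf₀, ht, ht.ne', not_lt_of_gt ht]
  have hprod : ∀ k l : ℝ → ℝ, (∀ t, k t * l t = 0) →
      J.mul (∑ t ∈ S, k t • p t) (∑ t ∈ S, l t • p t) = 0 := by
    intro k l hkl
    rw [h.sum_mul_sum]
    simp [hkl]
  have hidem : ∀ k : ℝ → ℝ, (∀ t, k t * k t = k t) →
      J.mul (∑ t ∈ S, k t • p t) (∑ t ∈ S, k t • p t) = ∑ t ∈ S, k t • p t := by
    intro k hk
    rw [h.sum_mul_sum]
    simp [hk]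
  have hcc : J.mul c c = c := hidem f fun t => by simp [hf]
  have hdd : J.mul d d = d := hidem f' fun t => by simp [hf']
  have hgg : J.mul g g = g := hidem f₀ fun t => by simp [hf₀]
  have hcd : J.mul c d = 0 := hprod f f' fun t => by
    simp only [hf, hf']; split_ifs <;> linarith
  have hgc : J.mul g c = 0 := hprod f₀ f fun t => by
    simp only [hf, hf₀]; split_ifs <;> linarith
  have hag : J.mul a g = 0 := by
    have := hprod id f₀ fun t => by simp only [hf₀, id]; split_ifs <;> simp_all
    simpa only [id, h.sum_smul] using this
  have hc' : c = ∑ t ∈ S with 0 < t, p t := by simp [hcdef, hf, Finset.sum_filter]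
  have hd' : d = ∑ t ∈ S with t < 0, p t := by simp [hddef, hf', Finset.sum_filter]
  have ha : a = ∑ t ∈ S with 0 < t, t • p t - ∑ t ∈ S with t < 0, (-t) • p t := by
    conv_lhs => rw [← h.sum_smul]
    rw [Finset.sum_filter, Finset.sum_filter, ← Finset.sum_sub_distrib]
    refine Finset.sum_congr rfl fun t _ => ?_
    rcases lt_trichotomy t 0 with ht | ht | ht
    · simp [ht, not_lt_of_gt ht]
    · simp [ht]
    · simp [ht, not_lt_of_gt ht]
  have ha' : -a = ∑ t ∈ S with t < 0, (-t) • p t - ∑ t ∈ S with 0 < t, t • p t := by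
    rw [← neg_sub, ← ha]
  have hcs : ∀ x, J.mul d x = 0 → ∃ τ : ℝ, J.mul c x = τ • c := fun x =>
    exists_mul_eq_smul (a := a) hcc (by rw [J.mul_comm, hcd]) fun x hx hax => by
      rw [hc']
      exact sum_mul_eq_zero hC (fun i hi => h.idem i (Finset.mem_filter.mp hi).1)
        (fun i hi => h.idem i (Finset.mem_filter.mp hi).1)
        (fun i hi => (Finset.mem_filter.mp hi).2) ha (hd' ▸ hx) hax
  have hds : ∀ x, J.mul c x = 0 → ∃ τ : ℝ, J.mul d x = τ • d := fun x =>
    exists_mul_eq_smul (a := -a) hdd hcd fun x hx hax => by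
      rw [hd']
      exact sum_mul_eq_zero (by simpa only [inner_neg_left, neg_inj, neg_eq_zero] using hC)
        (fun i hi => h.idem i (Finset.mem_filter.mp hi).1)
        (fun i hi => h.idem i (Finset.mem_filter.mp hi).1)
        (fun i hi => neg_pos.mpr (Finset.mem_filter.mp hi).2) ha' (hc' ▸ hx) hax
  rcases hJ.eq_zero_or_one hgg (commute_of_half_eq_zero hgg fun y hy =>
    eq_zero_of_mul_eq_half hcc hdd hgg hgc hsum hcs hds hy) with hg | hg
  · exfalso
    rw [hg, add_zero] at hsum
    have hone : ∀ x, J.mul c x + J.mul d x = x := fun x => by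
      rw [← LinearMap.add_apply, ← map_add, hsum, J.one_mul]
    refine hr.not_gt (rank_lt_three (exists_sq_eq hcc hdd hcd hsum ?_ ?_))
    · intro x hx
      obtain ⟨τ, hτ⟩ := hcs x (by simpa [hx] using hone x)
      exact ⟨τ, hx ▸ hτ⟩
    · intro x hx
      obtain ⟨τ, hτ⟩ := hds x (by simpa [hx] using hone x)
      exact ⟨τ, hx ▸ hτ⟩
  · rw [← J.mul_one a, ← hg, hag]

end Peirce

end EuclideanJordanAlgebra

theorem metricProj_cone_eq {E : Type*} [NormedAddCommGroup E] [InnerProductSpace ℝ E] {K : Set E}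
    {p q : E} (hp : p ∈ K) (hpq : ⟪p, q⟫_ℝ = 0) (hq : ∀ y ∈ K, 0 ≤ ⟪y, q⟫_ℝ) :
    metricProj K (p - q) = p := by
  have hle : ∀ y ∈ K, ‖q‖ ^ 2 + ‖p - y‖ ^ 2 ≤ ‖p - q - y‖ ^ 2 := by
    intro y hy
    have e : p - q - y = (p - y) - q := by abel
    rw [e, norm_sub_sq_real (p - y) q, inner_sub_left, hpq]
    linarith [hq y hy]
  have hex : ∃ z, z ∈ K ∧ ∀ y ∈ K, ‖p - q - z‖ ≤ ‖p - q - y‖ := by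
    refine ⟨p, hp, fun y hy => ?_⟩
    rw [show p - q - p = -q by abel, norm_neg]
    exact le_of_sq_le_sq ((le_add_of_nonneg_right (sq_nonneg _)).trans (hle y hy)) (norm_nonneg _)
  obtain ⟨hz, hmin⟩ := Classical.epsilon_spec hex
  change metricProj K (p - q) ∈ K at hz
  set z := metricProj K (p - q)
  have h1 : ‖p - q - z‖ ≤ ‖p - q - p‖ := hmin p hp
  rw [show p - q - p = -q by abel, norm_neg] at h1
  have h2 := hle z hz
  have h3 : ‖p - q - z‖ ^ 2 ≤ ‖q‖ ^ 2 := pow_le_pow_left₀ (norm_nonneg _) h1 2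
  have h4 : ‖p - z‖ = 0 := by nlinarith [norm_nonneg (p - z)]
  exact (sub_eq_zero.mp (norm_eq_zero.mp h4)).symm

/-- A lattice-like subspace contains the positive part of each of its elements. -/
theorem IsLatticeLike.mem_of_sub_mem {E : Type*} [NormedAddCommGroup E] [InnerProductSpace ℝ E]
    {K : Set E} {H : Submodule ℝ E} (h : IsLatticeLike K (H : Set E)) {p q : E} (hp : p ∈ K)
    (hpq : ⟪p, q⟫_ℝ = 0) (hq : ∀ y ∈ K, 0 ≤ ⟪y, q⟫_ℝ) (hH : p - q ∈ H) : p ∈ H := by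
  have := (h 0 H.zero_mem (p - q) hH).2
  simp only [coneSup, zero_add, Set.image_id'] at this
  rwa [metricProj_cone_eq hp hpq hq] at this

theorem mainTheorem9 {E : Type*} [NormedAddCommGroup E] [InnerProductSpace ℝ E]
    [FiniteDimensional ℝ E] (J : EuclideanJordanAlgebra E)
    {k : ℕ} (V : Fin k → Submodule ℝ E) (A : ∀ i, EuclideanJordanAlgebra (V i))
    (hV : J.IsSimpleDecomposition V A)
    (H : Submodule ℝ E) (hH : IsHyperplane H)
    (hlat : IsLatticeLike J.coneOfSquares (H : Set E)) :
    ∀ i : Fin k, 3 ≤ (A i).rank → V i ≤ H := by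
  intro i hr
  obtain ⟨a, -, ha⟩ := hH
  have hproj : ∀ x : V i, ⟪(V i).orthogonalProjectionOnto a, x⟫_ℝ = ⟪a, (x : E)⟫_ℝ := fun x =>
    Submodule.inner_orthogonalProjectionOnto_eq_of_mem_right x a
  have h0 : (V i).orthogonalProjectionOnto a = 0 := by
    refine (hV.isSimple i).eq_zero_of_rank hr fun u v huv heq => ?_
    rw [hproj, hproj] at heq
    rw [Submodule.coe_inner] at huv
    rw [hproj]
    simp only [hV.coe_mul] at *
    rw [← ha]
    refine hlat.mem_of_sub_mem ⟨u, rfl⟩ huv ?_ ?_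
    · rintro _ ⟨y, rfl⟩
      exact J.inner_sq_sq_nonneg _ _
    · rw [ha, inner_sub_right, heq, sub_self]
  intro x hx
  rw [ha, ← hproj ⟨x, hx⟩, h0, inner_zero_left]
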